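/- **Setting.** Let $E$ be a real vector space of dimension $8$ with a negative definite scalar product $\langle\cdot,\cdot\rangle$, and let $\mathfrak m=E\oplus\mathbb R p\oplus\mathbb R q$ be the Minkowski space in which $\langle p,E\rangle=\langle q,E\rangle=\langle p,p\rangle=\langle q,q\rangle=0$ and $\langle p,q\rangle=1$. For $e\in E$ put $e^\flat=\langle e,\cdot\rangle|_E\in E^*$. Let $b$ be a non-degenerate symmetric bilinear form on $E$ and let $B\in\mathrm{End}_{\mathbb R}(E)$ be given by $b(e,f)=-\langle Be,f\rangle$; assume the normalization $\operatorname{tr}(B^2)=8$, i.e. the eigenvalues $b_i$ of $B$ satisfy $\sum_i b_i^2=8$. The Cahen–Wallach algebra $\mathfrak g_b=E^*\oplus E\oplus\mathbb R p\oplus\mathbb R q$ is the Lie algebra whose only non-trivial brackets are $$[q,e]=e^\flat,\qquad [e^\flat,f]=b(e,f)\,p,\qquad [e^\flat,q]=Be\qquad(e,f\in E).$$ Clifford algebras use the convention $v^2=-\langle v,v\rangle$. Let $\rho_{\rm spin}:\mathrm{Cl}(\mathfrak m)\to\mathrm{End}_{\mathbb R}(S)$ be an irreducible real representation. A Lie algebra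 representation $\rho:\mathfrak g_b\to\mathfrak{gl}_{\mathbb R}(S)$ is called *spin* if $\rho(e^\flat)=\rho_{\rm spin}(p\wedge Be)$ for all $e\in E$, where $v\wedge w=\frac14(vw-wv)\in\mathrm{Cl}(\mathfrak m)$; it has *non-zero charge* if $\rho(p)\neq0$. **Theorem 4.5.** $\mathfrak g_b$ admits a spin representation of non-zero charge on $S$ if and only if $B=\mathrm{Id}$ or $B=-\mathrm{Id}$. In that case such a representation is given explicitly as follows. Let $V$ be any irreducible real $\mathrm{Cl}(E)$-module. Then $S=V\oplus V$, written in columns, is an irreducible $\mathrm{Cl}(\mathfrak m)$-module via $$e\mapsto\begin{pmatrix}-e&0\\0&e\end{pmatrix},\qquad p\mapsto\begin{pmatrix}0&2\sqrt2\\0&0\end{pmatrix},\qquad q\mapsto\begin{pmatrix}0&0\\-\frac1{\sqrt2}&0\end{pmatrix}.$$ Let $\pi^\pm=\frac12(\mathrm{Id}\pm e_1\cdots e_8)\in\mathrm{End}_{\mathbb R}(V)$ be the projections on the semi-spinors, where $e_1,\dots,e_8$ is any basis of $E$ that is orthonormal for $-\langle\cdot,\cdot\rangle$. If $B=\varepsilon\,\mathrm{Id}$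 with $\varepsilon\in\{1,-1\}$, then $$\rho(e^\flat)=\sqrt2\begin{pmatrix}0&Be\\0&0\end{pmatrix},\quad \rho(e)=\sqrt2\begin{pmatrix}-e\circ\pi^-&0\\0&e\circ\pi^+\end{pmatrix},\quad \rho(p)=4\begin{pmatrix}0&\pi^+\\0&0\end{pmatrix},\quad \rho(q)=\begin{pmatrix}0&\varepsilon\,\mathrm{Id}\\-\pi^-&0\end{pmatrix}$$ defines a spin representation of $\mathfrak g_b$ on $S$ of non-zero charge. -/

import Mathlib

open Module

attribute [local instance 100] LieRing.ofAssociativeRing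

namespace CahenWallach

noncomputable section

section Minkowski

variable (E : Type*) [NormedAddCommGroup E] [InnerProductSpace ℝ E]

/-- The negative definite scalar product `⟨e, f⟩ = -(e, f)` on the Euclidean space `E`. -/
def scalarE : LinearMap.BilinForm ℝ E := -(innerₗ E)

variable {E} in
@[simp] theorem scalarE_apply (e f : E) : scalarE E e f = -inner ℝ e f := rfl

theorem scalarE_nondegenerate : (scalarE E).Nondegenerate := by
  constructor
  · intro x h
    have := h x
    simpa using this
  · intro x h
    have := h x
    simpa using this

/-- The Minkowski space `𝔪 = E ⊕ ℝ𝐩 ⊕ ℝ𝐪`; the triple `(e, s, t)` stands for `e + s𝐩 + t𝐪`. -/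
abbrev Minkowski : Type _ := E × ℝ × ℝ

/-- The Lorentzian scalar product of signature `(+, -, …, -)` on `𝔪`: negative definite on `E`,
with `𝐩, 𝐪` isotropic, orthogonal to `E`, and `⟨𝐩, 𝐪⟩ = 1`. -/
def scalarM : LinearMap.BilinForm ℝ (Minkowski E) :=
  LinearMap.mk₂ ℝ (fun v w => scalarE E v.1 w.1 + v.2.1 * w.2.2 + v.2.2 * w.2.1)
    (by intro v v' w; simp only [Prod.fst_add, Prod.snd_add, map_add, LinearMap.add_apply]; ring)
    (by intro c v w; simp only [Prod.smul_fst, Prod.smul_snd, map_smul, LinearMap.smul_apply,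
          smul_eq_mul]; ring)
    (by intro v w w'; simp only [Prod.fst_add, Prod.snd_add, map_add]; ring)
    (by intro c v w; simp only [Prod.smul_fst, Prod.smul_snd, map_smul, smul_eq_mul]; ring)

/-- The Clifford algebra `Cl(E)`, with the sign convention `v * v = -⟨v, v⟩`. -/
abbrev ClE : Type _ := CliffordAlgebra (-(scalarE E).toQuadraticMap)

/-- The Clifford algebra `Cl(𝔪)`, with the sign convention `v * v = -⟨v, v⟩`. -/
abbrev ClM : Type _ := CliffordAlgebra (-(scalarM E).toQuadraticMap)

variable {E}

/-- The inclusion of `E` into `Cl(E)`. -/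
def inE : E →ₗ[ℝ] ClE E := CliffordAlgebra.ι _

/-- The inclusion of `𝔪` into `Cl(𝔪)`. -/
def inM : Minkowski E →ₗ[ℝ] ClM E := CliffordAlgebra.ι _

/-- The isotropic vector `𝐩 ∈ 𝔪`. -/
def vecP : Minkowski E := (0, 1, 0)

/-- The image `¼ [v, w]` in `Cl(𝔪)` of the element
`v ∧ w = ⟨v, ·⟩ w - ⟨w, ·⟩ v` of `𝔰𝔬(𝔪)`. -/
def wedge (v w : Minkowski E) : ClM E :=
  (1 / 4 : ℝ) • (inM v * inM w - inM w * inM v)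

end Minkowski

section Representations

variable {A S : Type*} [Ring A] [Algebra ℝ A] [AddCommGroup S] [Module ℝ S]

/-- A representation `γ` of the real algebra `A` on the real vector space `S` is irreducible:
`S ≠ 0` and there are no invariant subspaces besides `0` and `S`. -/
def IsIrreducible (γ : A →ₐ[ℝ] End ℝ S) : Prop :=
  Nontrivial S ∧ ∀ W : Submodule ℝ S, (∀ a : A, ∀ x ∈ W, γ a x ∈ W) → W = ⊥ ∨ W = ⊤

/-- The endomorphism of `S ⊕ S` with block matrix `(a b; c d)`, acting on columns. -/
def block (a b c d : End ℝ S) : End ℝ (S × S) :=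
  (a.coprod b).prod (c.coprod d)

@[simp] theorem block_apply (a b c d : End ℝ S) (x : S × S) :
    block a b c d x = (a x.1 + b x.2, c x.1 + d x.2) := rfl

end Representations

section Algebra

variable (E : Type*) [NormedAddCommGroup E] [InnerProductSpace ℝ E]

/-- A non-degenerate symmetric bilinear form `b` on `E`. -/
structure CWForm where
  /-- the bilinear form -/
  form : LinearMap.BilinForm ℝ E
  symm : form.IsSymm
  nondegenerate : form.Nondegenerate

variable {E}

/-- The underlying vector space `E* ⊕ E ⊕ ℝ𝐩 ⊕ ℝ𝐪` of the Cahen-Wallach algebra `𝔤_b`. -/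
def CWAlgebra (_b : CWForm E) : Type _ := Dual ℝ E × E × ℝ × ℝ

namespace CWAlgebra

variable {b : CWForm E}

instance : AddCommGroup (CWAlgebra b) := inferInstanceAs (AddCommGroup (Dual ℝ E × E × ℝ × ℝ))

instance : Module ℝ (CWAlgebra b) := inferInstanceAs (Module ℝ (Dual ℝ E × E × ℝ × ℝ))

/-- The element `ξ + e + s𝐩 + t𝐪` of `𝔤_b`. -/
def mk (ξ : Dual ℝ E) (e : E) (s t : ℝ) : CWAlgebra b := (ξ, e, s, t)

/-- The `E*`-component. -/
def dual (x : CWAlgebra b) : Dual ℝ E := x.1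
/-- The `E`-component. -/
def vec (x : CWAlgebra b) : E := x.2.1
/-- The `𝐩`-coordinate. -/
def pc (x : CWAlgebra b) : ℝ := x.2.2.1
/-- The `𝐪`-coordinate. -/
def qc (x : CWAlgebra b) : ℝ := x.2.2.2

@[ext] theorem ext {x y : CWAlgebra b} (h1 : x.dual = y.dual) (h2 : x.vec = y.vec)
    (h3 : x.pc = y.pc) (h4 : x.qc = y.qc) : x = y :=
  Prod.ext h1 (Prod.ext h2 (Prod.ext h3 h4))

@[simp] theorem dual_mk (ξ : Dual ℝ E) (e : E) (s t : ℝ) : (mk ξ e s t : CWAlgebra b).dual = ξ := rfl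
@[simp] theorem vec_mk (ξ : Dual ℝ E) (e : E) (s t : ℝ) : (mk ξ e s t : CWAlgebra b).vec = e := rfl
@[simp] theorem pc_mk (ξ : Dual ℝ E) (e : E) (s t : ℝ) : (mk ξ e s t : CWAlgebra b).pc = s := rfl
@[simp] theorem qc_mk (ξ : Dual ℝ E) (e : E) (s t : ℝ) : (mk ξ e s t : CWAlgebra b).qc = t := rfl
@[simp] theorem dual_add (x y : CWAlgebra b) : (x + y).dual = x.dual + y.dual := rfl
@[simp] theorem vec_add (x y : CWAlgebra b) : (x + y).vec = x.vec + y.vec := rfl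
@[simp] theorem pc_add (x y : CWAlgebra b) : (x + y).pc = x.pc + y.pc := rfl
@[simp] theorem qc_add (x y : CWAlgebra b) : (x + y).qc = x.qc + y.qc := rfl
@[simp] theorem dual_smul (c : ℝ) (x : CWAlgebra b) : (c • x).dual = c • x.dual := rfl
@[simp] theorem vec_smul (c : ℝ) (x : CWAlgebra b) : (c • x).vec = c • x.vec := rfl
@[simp] theorem pc_smul (c : ℝ) (x : CWAlgebra b) : (c • x).pc = c * x.pc := rfl
@[simp] theorem qc_smul (c : ℝ) (x : CWAlgebra b) : (c • x).qc = c * x.qc := rfl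
@[simp] theorem dual_zero : (0 : CWAlgebra b).dual = 0 := rfl
@[simp] theorem vec_zero : (0 : CWAlgebra b).vec = 0 := rfl
@[simp] theorem pc_zero : (0 : CWAlgebra b).pc = 0 := rfl
@[simp] theorem qc_zero : (0 : CWAlgebra b).qc = 0 := rfl

end CWAlgebra

variable [FiniteDimensional ℝ E]

variable (E) in
/-- The musical isomorphism `e ↦ e♭ = ⟨e, ·⟩|_E`; its inverse is `♯`. -/
def flat : E ≃ₗ[ℝ] Dual ℝ E := (scalarE E).toDual (scalarE_nondegenerate E)

/-- The symmetric endomorphism `B` of `E` with `b(e, f) = -⟨B e, f⟩`. -/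
def CWForm.endo (b : CWForm E) : End ℝ E := -((flat E).symm.toLinearMap ∘ₗ b.form)

theorem CWForm.form_eq (b : CWForm E) (e f : E) : b.form e f = -scalarE E (b.endo e) f := by
  have h : scalarE E ((flat E).symm (b.form e)) f = b.form e f :=
    LinearMap.BilinForm.apply_toDual_symm_apply (hB := scalarE_nondegenerate E) _ _
  rw [← h]
  simp only [CWForm.endo, LinearMap.neg_apply, LinearMap.comp_apply, LinearEquiv.coe_coe, map_neg,
    neg_neg]

namespace CWAlgebra

variable {b : CWForm E}

/-- The bracket of `𝔤_b`, with non-trivial relations `[𝐪, e] = e♭`, `[e♭, f] = b(e, f) 𝐩`,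
`[e♭, 𝐪] = B e`. -/
instance : Bracket (CWAlgebra b) (CWAlgebra b) where
  bracket x y := mk
    (x.qc • flat E y.vec - y.qc • flat E x.vec)
    (y.qc • b.endo ((flat E).symm x.dual) - x.qc • b.endo ((flat E).symm y.dual))
    (b.form ((flat E).symm x.dual) y.vec - b.form ((flat E).symm y.dual) x.vec)
    0

theorem bracket_def (x y : CWAlgebra b) : ⁅x, y⁆ = mk
    (x.qc • flat E y.vec - y.qc • flat E x.vec)
    (y.qc • b.endo ((flat E).symm x.dual) - x.qc • b.endo ((flat E).symm y.dual))
    (b.form ((flat E).symm x.dual) y.vec - b.form ((flat E).symm y.dual) x.vec)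
    0 := rfl

instance : LieRing (CWAlgebra b) where
  add_lie x y z := by
    ext1 <;> simp [bracket_def, add_smul] <;> abel
  lie_add x y z := by
    ext1 <;> simp [bracket_def, add_smul] <;> abel
  lie_self x := by
    ext1 <;> simp [bracket_def]
  leibniz_lie x y z := by
    have hs : ∀ u v : E, b.form u (b.endo v) = b.form v (b.endo u) := by
      intro u v
      rw [b.form_eq, b.form_eq, scalarE_apply, scalarE_apply, real_inner_comm]
    ext1
    · simp [bracket_def, smul_sub, smul_smul, mul_comm]
    · simp [bracket_def, smul_sub, smul_smul, mul_comm]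
    · simp only [bracket_def, dual_mk, vec_mk, pc_mk, qc_mk, pc_add, map_sub, map_smul,
        LinearMap.sub_apply, LinearMap.smul_apply, smul_eq_mul, LinearEquiv.symm_apply_apply]
      rw [hs ((flat E).symm y.dual) ((flat E).symm x.dual),
        hs ((flat E).symm z.dual) ((flat E).symm x.dual),
        hs ((flat E).symm z.dual) ((flat E).symm y.dual), b.symm.eq x.vec y.vec,
        b.symm.eq x.vec z.vec, b.symm.eq y.vec z.vec]
      ring
    · simp [bracket_def]

instance : LieAlgebra ℝ (CWAlgebra b) where
  lie_smul c x y := by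
    ext1 <;> simp [bracket_def, smul_sub, smul_smul, mul_comm]
    ring

/-- The inclusion of `E* = 𝔥`. -/
def ofDual (ξ : Dual ℝ E) : CWAlgebra b := mk ξ 0 0 0
/-- The inclusion of `E`. -/
def ofVec (e : E) : CWAlgebra b := mk 0 e 0 0
variable (b) in
/-- The central element `𝐩`. -/
def p : CWAlgebra b := mk 0 0 1 0
variable (b) in
/-- The element `𝐪`. -/
def q : CWAlgebra b := mk 0 0 0 1

end CWAlgebra

/-- Given a Clifford representation `ρ_spin : Cl(𝔪) → End(S)`, a representation `ρ` of `𝔤_b` on `S`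
is spin if it restricts on `E*` to `ρ_spin` composed with the isotropy representation
`e♭ ↦ 𝐩 ∧ B e ∈ 𝔰𝔬(𝔪) ⊆ Cl(𝔪)`. -/
def IsSpin {b : CWForm E} {S : Type*} [AddCommGroup S] [Module ℝ S]
    (ρspin : ClM E →ₐ[ℝ] End ℝ S) (ρ : CWAlgebra b →ₗ⁅ℝ⁆ End ℝ S) : Prop :=
  ∀ e : E, ρ (CWAlgebra.ofDual (flat E e)) = ρspin (wedge vecP (b.endo e, 0, 0))

/-- The Cahen-Wallach algebra `𝔤_b` has a spin representation of non-zero charge on the Clifford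
module `S`, that is, one with `ρ(𝐩) ≠ 0`. -/
def HasNonzeroChargeSpinRep (b : CWForm E) {S : Type*} [AddCommGroup S] [Module ℝ S]
    (ρspin : ClM E →ₐ[ℝ] End ℝ S) : Prop :=
  ∃ ρ : CWAlgebra b →ₗ⁅ℝ⁆ End ℝ S, IsSpin ρspin ρ ∧ ρ (CWAlgebra.p b) ≠ 0

end Algebra

section Model

variable {E : Type*} [NormedAddCommGroup E] [InnerProductSpace ℝ E]
variable {V : Type*} [AddCommGroup V] [Module ℝ V]

/-- Clifford multiplication by vectors of `𝔪` on `S = S₋ ⊕ S₊ = V ⊕ V`, where `V` is a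
`Cl(E)`-module: `e ↦ (-e 0; 0 e)`, `𝐩 ↦ (0 2√2; 0 0)`, `𝐪 ↦ (0 0; -1/√2 0)`. -/
def modelVec (γ : ClE E →ₐ[ℝ] End ℝ V) : Minkowski E →ₗ[ℝ] End ℝ (V × V) where
  toFun v := block (-γ (inE v.1)) ((2 * √2 * v.2.1) • 1) ((-(1 / √2) * v.2.2) • 1) (γ (inE v.1))
  map_add' v w := by
    ext x <;> simp [mul_add, add_smul, add_comm]
  map_smul' c v := by
    ext x <;> simp [smul_smul, mul_left_comm]

theorem modelVec_sq (γ : ClE E →ₐ[ℝ] End ℝ V) (v : Minkowski E) :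
    modelVec γ v * modelVec γ v =
      algebraMap ℝ (End ℝ (V × V)) ((-(scalarM E).toQuadraticMap) v) := by
  have h : ∀ x : V, γ (inE v.1) (γ (inE v.1) x) = (-(scalarE E v.1 v.1)) • x := by
    intro x
    have h1 : inE v.1 * inE v.1 = algebraMap ℝ (ClE E) (-(scalarE E v.1 v.1)) :=
      CliffordAlgebra.ι_sq_scalar _ v.1
    have h2 := congrArg (fun c => γ c x) h1
    simpa only [map_mul, AlgHom.commutes, Module.End.mul_apply,
      Module.algebraMap_end_apply] using h2
  have h0 : √2 ≠ 0 := by positivity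
  have hQ : (-(scalarM E).toQuadraticMap) v = -(scalarE E v.1 v.1) - 2 * v.2.1 * v.2.2 := by
    simp [scalarM]
    ring
  have e1 : 2 * √2 * v.2.1 * ((√2)⁻¹ * v.2.2) = 2 * v.2.1 * v.2.2 := by
    field_simp
  have e2 : (√2)⁻¹ * v.2.2 * (2 * √2 * v.2.1) = 2 * v.2.1 * v.2.2 := by
    field_simp
  rw [hQ]
  refine LinearMap.ext fun x => ?_
  rw [Module.End.mul_apply, Module.algebraMap_end_apply]
  apply Prod.ext
  · simp [modelVec, h, smul_smul, sub_smul, e1]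
    abel
  · simp [modelVec, h, smul_smul, sub_smul, e2]
    abel

/-- The `Cl(𝔪)`-module `S = S₋ ⊕ S₊` built from a `Cl(E)`-module `V`. -/
def model (γ : ClE E →ₐ[ℝ] End ℝ V) : ClM E →ₐ[ℝ] End ℝ (V × V) :=
  CliffordAlgebra.lift _ ⟨modelVec γ, modelVec_sq γ⟩

/-- The projections `π⁺` (for `s = 1`) and `π⁻` (for `s = -1`) of `V` onto the `±1`-eigenspaces
(semi-spinors) of the volume element `e₁ ⋯ e₈` of an orthonormal basis. -/
def semiProj (γ : ClE E →ₐ[ℝ] End ℝ V) (u : OrthonormalBasis (Fin 8) ℝ E) (s : ℝ) : End ℝ V :=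
  (1 / 2 : ℝ) • (1 + s • γ (List.ofFn fun i => inE (u i)).prod)

end Model

end

end CahenWallach

/-!
Let `N v = ρ(v♭)` for `v` in `E`, `K = ρ(𝐪)` and `Z = ρ(𝐩)`. In a spin representation `N v` is the
product of `𝐩` with Clifford multiplication by `B v`, up to a factor, and the brackets of `𝔤_b` give
`[K, [N v, K]] = N (B v)` and `[N v, [N v, K]] = ‖B v‖² Z` with `Z` commuting with `K`. Squares of
the `N v` vanish, so the second relation makes `G = 𝐩 K 𝐩` semi-commute with all Clifford
multiplications, and `G ≠ 0` if `Z ≠ 0`. Together with the first relation this shows that, for a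
unit vector `v`, the Clifford multiplications by `v` and `B v` commute after multiplication by `G`.
Hence every `v` is an eigenvector of `B`, and `B` is a multiple of the identity.

Conversely, let `θ = ½(1 + τ)` be the half-spin projection, where `τ` is the volume element of
`Cl(𝔪)`: it squares to `1` and anticommutes with `𝔪`, so `v θ = (1 - θ) v` for all `v` in `𝔪`. If
`B = r • id`, then `θ` turns Clifford multiplication into a representation of `𝔤_b`, sending `e`,
`𝐩` and `𝐪` to multiples of `θ e`, of `θ 𝐩`, and to a combination of `𝐩` and `θ 𝐪`.
-/

namespace CahenWallach

noncomputable section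

section Clifford

variable {E A : Type*} [NormedAddCommGroup E] [InnerProductSpace ℝ E] [Ring A] [Algebra ℝ A]

/-- Clifford multiplication by the vectors of a Euclidean space: a linear map `c` with
`c v * c v = ‖v‖²`, stated in polarized form. -/
def IsClifford (c : E →ₗ[ℝ] A) : Prop :=
  ∀ v w, c v * c w + c w * c v = (2 * inner ℝ v w : ℝ) • 1

variable {c : E →ₗ[ℝ] A}

theorem IsClifford.mul_self (hc : IsClifford c) (v : E) : c v * c v = (inner ℝ v v : ℝ) • 1 := by
  have h := hc v v
  rw [← two_smul ℝ, mul_smul] at h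
  exact smul_right_injective A two_ne_zero h

theorem IsClifford.mul_self_of_norm_eq_one (hc : IsClifford c) {v : E} (hv : ‖v‖ = 1) :
    c v * c v = 1 := by
  rw [hc.mul_self, real_inner_self_eq_norm_sq, hv, one_pow, one_smul]

theorem IsClifford.mul_eq_neg_of_inner_eq_zero (hc : IsClifford c) {v w : E}
    (h : inner ℝ v w = (0 : ℝ)) : c v * c w = -(c w * c v) := by
  rw [eq_neg_iff_add_eq_zero, hc, h, mul_zero, zero_smul]

theorem IsClifford.eq_zero_of_mul_eq_zero (hc : IsClifford c) {G : A} (hG : G ≠ 0) {v : E}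
    (h : G * c v = 0) : v = 0 := by
  have h' : (inner ℝ v v : ℝ) • G = 0 := by
    rw [← mul_one G, ← mul_smul_comm, ← hc.mul_self, ← mul_assoc, h, zero_mul]
  exact inner_self_eq_zero.mp ((smul_eq_zero.mp h').resolve_right hG)

theorem IsClifford.semiconj_of_conj (hc : IsClifford c) {G H : A}
    (h : ∀ v, c v * G * c v = (inner ℝ v v : ℝ) • H) (v : E) :
    G * c v = c v * H ∧ c v * G = H * c v := by
  rcases eq_or_ne v 0 with rfl | hv
  · simp only [map_zero, mul_zero, zero_mul, and_self]
  have hv' : (inner ℝ v v : ℝ) ≠ 0 := inner_self_ne_zero.mpr hv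
  constructor <;> refine smul_right_injective A hv' ?_ <;> dsimp only
  · calc (inner ℝ v v : ℝ) • (G * c v) = c v * c v * G * c v := by
          rw [hc.mul_self, smul_one_mul, smul_mul_assoc]
      _ = (inner ℝ v v : ℝ) • (c v * H) := by
          rw [mul_assoc (c v), mul_assoc, h, mul_smul_comm]
  · calc (inner ℝ v v : ℝ) • (c v * G) = c v * G * (c v * c v) := by
          rw [hc.mul_self, mul_smul_comm, mul_one]
      _ = (inner ℝ v v : ℝ) • (H * c v) := by
          rw [← mul_assoc, h, smul_mul_assoc]

end Clifford

section Eigenvectors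

section Ring

variable {R : Type*} [Ring R] {n e f K N : R}

theorem lie_lie_eq (K N : R) : ⁅K, ⁅N, K⁆⁆ = 2 * (K * N * K) - K * K * N - N * K * K := by
  simp only [LieRing.of_associative_ring_bracket]
  noncomm_ring

theorem lie_lie_eq_of_mul_self_eq_zero (hN : N * N = 0) (K : R) :
    ⁅N, ⁅N, K⁆⁆ = -(2 * (N * K * N)) := by
  calc ⁅N, ⁅N, K⁆⁆ = N * N * K - 2 * (N * K * N) + K * (N * N) := by
        simp only [LieRing.of_associative_ring_bracket]; noncomm_ring
    _ = -(2 * (N * K * N)) := by rw [hN]; noncomm_ring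

theorem mul_sq_mul_of_mul_lie_lie_eq_zero (hnN : n * N = 0) (h : n * ⁅K, ⁅N, K⁆⁆ = 0) :
    n * K * K * N = 2 * (n * K * N * K) := by
  calc n * K * K * N = 2 * (n * K * N * K) - n * N * K * K - n * ⁅K, ⁅N, K⁆⁆ := by
        rw [lie_lie_eq]; noncomm_ring
    _ = 2 * (n * K * N * K) := by rw [h, hnN]; noncomm_ring

theorem mul_sq_mul_of_lie_lie_mul_eq_zero (hNn : N * n = 0) (h : ⁅K, ⁅N, K⁆⁆ * n = 0) :
    N * K * K * n = 2 * (K * N * K * n) := by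
  calc N * K * K * n = 2 * (K * N * K * n) - K * K * (N * n) - ⁅K, ⁅N, K⁆⁆ * n := by
        rw [lie_lie_eq]; noncomm_ring
    _ = 2 * (K * N * K * n) := by rw [h, hNn]; noncomm_ring

/-- Both occurrences of `n * f` are replaced by the double commutator with `N = n * e`. -/
theorem mul_lie_lie_mul_eq_neg (he : e * e = 1) (hen : e * n = -(n * e)) (hn : n * n = 0)
    (hfn : f * n = -(n * f)) (hK : ⁅K, ⁅n * e, K⁆⁆ = n * f)
    (hcomm : Commute (n * e * K * (n * e)) K) :
    n * K * (n * f) * e = -(e * (n * f) * K * n) := by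
  obtain ⟨N, hN⟩ : ∃ N, N = n * e := ⟨_, rfl⟩
  rw [← hN] at hK hcomm
  have hNe : N * e = n := by rw [hN, mul_assoc, he, mul_one]
  have heN : e * N = -n := by rw [hN, ← mul_assoc, hen, neg_mul, mul_assoc, he, mul_one]
  have hnKKN : n * K * K * N = 2 * (n * K * N * K) := by
    refine mul_sq_mul_of_mul_lie_lie_eq_zero ?_ ?_
    · rw [hN, ← mul_assoc, hn, zero_mul]
    · rw [hK, ← mul_assoc, hn, zero_mul]
  have hNKKn : N * K * K * n = 2 * (K * N * K * n) := by
    refine mul_sq_mul_of_lie_lie_mul_eq_zero ?_ ?_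
    · rw [hN, mul_assoc, hen, mul_neg, ← mul_assoc, hn, zero_mul, neg_zero]
    · rw [hK, mul_assoc, hfn, mul_neg, ← mul_assoc, hn, zero_mul, neg_zero]
  rw [← hK, lie_lie_eq]
  calc n * K * (2 * (K * N * K) - K * K * N - N * K * K) * e
      = 2 * (n * K * K * N * K * e) - n * K * K * K * (N * e) - n * K * N * K * K * e := by
        noncomm_ring
    _ = 3 * (n * K * N * K * K * e) - n * K * K * K * n := by rw [hnKKN, hNe]; noncomm_ring
    _ = -(3 * (e * (N * K * N * (K * K)) * e)) - n * K * K * K * n := by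
        nth_rw 1 [← neg_neg n, ← heN]; noncomm_ring
    _ = -(3 * (e * K * K * N * K * (N * e)) + n * K * K * K * n) := by
        rw [(hcomm.mul_right hcomm).eq]; noncomm_ring
    _ = -(2 * (e * K * (N * K * K * n)) - e * K * K * N * K * n - e * N * K * K * K * n) := by
        rw [hNKKn, hNe, heN]; noncomm_ring
    _ = -(e * (2 * (K * N * K) - K * K * N - N * K * K) * K * n) := by noncomm_ring

theorem conj_mul_mul_eq_mul_mul_conj (he : e * e = 1) (hen : e * n = -(n * e)) (hn : n * n = 0)
    (hfn : f * n = -(n * f)) (hK : ⁅K, ⁅n * e, K⁆⁆ = n * f)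
    (hcomm : Commute (n * e * K * (n * e)) K) :
    n * K * n * f * e = e * f * (n * K * n) := by
  calc n * K * n * f * e = n * K * (n * f) * e := by noncomm_ring
    _ = -(e * (n * f) * K * n) := mul_lie_lie_mul_eq_neg he hen hn hfn hK hcomm
    _ = e * f * (n * K * n) := by rw [← neg_eq_iff_eq_neg.mpr hfn]; noncomm_ring

end Ring

variable {E A : Type*} [NormedAddCommGroup E] [InnerProductSpace ℝ E] [Ring A] [Algebra ℝ A]
  {c : E →ₗ[ℝ] A} {B : End ℝ E}

theorem exists_eq_smul_id_of_forall_norm_eq_one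
    (h : ∀ v : E, ‖v‖ = 1 → ∃ r : ℝ, B v = r • v) : ∃ r : ℝ, B = r • LinearMap.id := by
  refine LinearMap.exists_eq_smul_id_of_forall_notLinearIndependent fun v hv => ?_
  have hv0 : v ≠ 0 := hv.ne_zero 0
  obtain ⟨r, hr⟩ := h ((‖v‖⁻¹ : ℝ) • v) (norm_smul_inv_norm hv0)
  rw [map_smul, smul_comm] at hr
  have hBv : B v = r • v := smul_right_injective E (inv_ne_zero (norm_ne_zero_iff.mpr hv0)) hr
  exact (LinearIndependent.pair_iff' hv0).mp hv r hBv.symm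

theorem IsClifford.eq_inner_smul_of_mul_right_comm (hc : IsClifford c) {G : A} (hG : G ≠ 0)
    {v w : E} (hv : ‖v‖ = 1) (h : G * c w * c v = G * c v * c w) : w = (inner ℝ v w : ℝ) • v := by
  have hww : G * c w * c v = (inner ℝ v w : ℝ) • G := by
    refine smul_right_injective A (two_ne_zero (α := ℝ)) ?_
    dsimp only
    rw [two_smul]
    nth_rw 1 [h]
    rw [mul_assoc, mul_assoc, ← mul_add, hc, mul_smul_comm, mul_one, mul_smul]
  have hw : G * c w = (inner ℝ v w : ℝ) • (G * c v) := by
    rw [← smul_mul_assoc, ← hww, mul_assoc _ (c v), hc.mul_self_of_norm_eq_one hv, mul_one]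
  refine sub_eq_zero.mp (hc.eq_zero_of_mul_eq_zero hG ?_)
  rw [map_sub, map_smul, mul_sub, mul_smul_comm, hw, sub_self]

variable {P K Z : A}

theorem conj_eq_smul_of_lie_lie (hPP : P * P = 0)
    (hcP : ∀ v, c v * P = -(P * c v))
    (hZ : ∀ v, ⁅P * c v, ⁅P * c v, K⁆⁆ = (inner ℝ v v : ℝ) • Z) (v : E) :
    P * c v * K * (P * c v) = (inner ℝ v v : ℝ) • -((1 / 2 : ℝ) • Z) ∧
      c v * (P * K * P) * c v = (inner ℝ v v : ℝ) • ((1 / 2 : ℝ) • Z) := by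
  have hN : P * c v * (P * c v) = 0 := by
    rw [mul_assoc, ← mul_assoc (c v), hcP, neg_mul, mul_assoc, mul_neg, ← mul_assoc, hPP, zero_mul,
      neg_zero]
  have h := hZ v
  rw [lie_lie_eq_of_mul_self_eq_zero hN, neg_eq_iff_eq_neg] at h
  have h1 : P * c v * K * (P * c v) = (inner ℝ v v : ℝ) • -((1 / 2 : ℝ) • Z) := by
    rw [smul_neg, smul_comm, ← smul_neg, ← h, two_mul, ← two_smul ℝ, smul_smul]
    norm_num
  refine ⟨h1, ?_⟩
  calc c v * (P * K * P) * c v = c v * P * K * (P * c v) := by noncomm_ring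
    _ = -(P * c v * K * (P * c v)) := by rw [hcP]; noncomm_ring
    _ = (inner ℝ v v : ℝ) • ((1 / 2 : ℝ) • Z) := by rw [h1, smul_neg, neg_neg]

theorem exists_eq_smul_id_of_lie_lie (hc : IsClifford c) (hPP : P * P = 0)
    (hcP : ∀ v, c v * P = -(P * c v)) (hZ0 : Z ≠ 0) (hZK : Commute Z K)
    (hZ : ∀ v, ⁅P * c v, ⁅P * c v, K⁆⁆ = (inner ℝ v v : ℝ) • Z)
    (hB : ∀ v, ⁅K, ⁅P * c v, K⁆⁆ = P * c (B v)) : ∃ r : ℝ, B = r • LinearMap.id := by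
  have hconj := fun v => conj_eq_smul_of_lie_lie hPP hcP hZ v
  refine exists_eq_smul_id_of_forall_norm_eq_one fun v hv => ⟨inner ℝ v (B v), ?_⟩
  have hG : P * K * P ≠ 0 := fun hG => hZ0 <| by
    simpa only [hG, mul_zero, zero_mul, real_inner_self_eq_norm_sq, hv, one_pow, one_smul, one_div,
      eq_comm (a := (0 : A)), smul_eq_zero, inv_eq_zero, OfNat.ofNat_ne_zero, false_or]
      using (hconj v).2
  have hswap := hc.semiconj_of_conj fun v => (hconj v).2
  refine hc.eq_inner_smul_of_mul_right_comm hG hv ?_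
  calc P * K * P * c (B v) * c v = c v * c (B v) * (P * K * P) := by
        refine conj_mul_mul_eq_mul_mul_conj (hc.mul_self_of_norm_eq_one hv) (hcP v) hPP (hcP _)
          (hB v) ?_
        rw [(hconj v).1]
        exact ((hZK.smul_left _).neg_left).smul_left _
    _ = P * K * P * c v * c (B v) := by
        rw [mul_assoc, (hswap _).2, ← mul_assoc, ← (hswap _).1]

end Eigenvectors

section Volume

variable {R : Type*} [Ring R] {x : R} {l : List R}

theorem mul_list_prod_of_anticommute (h : ∀ y ∈ l, x * y = -(y * x)) :
    x * l.prod = (-1 : ℤ) ^ l.length • (l.prod * x) := by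
  induction l with
  | nil => simp only [List.prod_nil, List.length_nil, mul_one, one_mul, pow_zero, one_smul]
  | cons y l ih =>
    rw [List.forall_mem_cons] at h
    rw [List.prod_cons, List.length_cons, ← mul_assoc, h.1, neg_mul, mul_assoc, ih h.2,
      mul_smul_comm, mul_assoc, pow_succ', neg_one_mul, neg_smul]

theorem mul_list_prod_of_mem (hx : x ∈ l) (hl : l.Pairwise fun y z => y * z = -(z * y)) :
    x * l.prod = (-1 : ℤ) ^ (l.length + 1) • (l.prod * x) := by
  induction l with
  | nil => exact absurd hx List.not_mem_nil
  | cons y l ih =>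
    rw [List.pairwise_cons] at hl
    rw [List.prod_cons, List.length_cons]
    rcases List.mem_cons.mp hx with rfl | hxl
    · rw [pow_add _ _ 2, neg_one_sq, mul_one, mul_assoc, ← mul_smul_comm,
        mul_list_prod_of_anticommute hl.1]
    · rw [← mul_assoc, ← neg_eq_iff_eq_neg.mpr (hl.1 x hxl), neg_mul, mul_assoc, ih hxl hl.2,
        mul_smul_comm, mul_assoc, pow_succ' _ (l.length + 1), neg_one_mul, neg_smul]

theorem list_prod_mul_self_of_anticommute (hsq : ∀ x ∈ l, x * x = 1)
    (hl : l.Pairwise fun y z => y * z = -(z * y)) :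
    l.prod * l.prod = (-1 : ℤ) ^ l.length.choose 2 • 1 := by
  induction l with
  | nil => simp only [List.prod_nil, List.length_nil, mul_one, Nat.choose_zero_succ, pow_zero,
      one_smul]
  | cons x l ih =>
    rw [List.pairwise_cons] at hl
    rw [List.forall_mem_cons] at hsq
    calc (x :: l).prod * (x :: l).prod = x * l.prod * (x * l.prod) := by rw [List.prod_cons]
      _ = (-1 : ℤ) ^ l.length • (l.prod * (x * x) * l.prod) := by
          nth_rw 1 [mul_list_prod_of_anticommute hl.1]
          rw [smul_mul_assoc]
          noncomm_ring
      _ = (-1 : ℤ) ^ l.length • (-1 : ℤ) ^ l.length.choose 2 • 1 := by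
          rw [hsq.1, mul_one, ih hsq.2 hl.2]
      _ = (-1 : ℤ) ^ (x :: l).length.choose 2 • 1 := by
          rw [smul_smul, ← pow_add, List.length_cons, Nat.choose_succ_succ' _ 1,
            Nat.choose_one_right]

variable {E A : Type*} [NormedAddCommGroup E] [InnerProductSpace ℝ E] [Ring A] [Algebra ℝ A]
  {n : ℕ}

/-- The volume element `c e₁ ⋯ c eₙ` of an orthonormal basis `e₁, …, eₙ` under a Clifford
multiplication `c`. -/
def cliffordVolume (c : E →ₗ[ℝ] A) (u : OrthonormalBasis (Fin n) ℝ E) : A :=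
  (List.ofFn fun i => c (u i)).prod

variable {c : E →ₗ[ℝ] A} (u : OrthonormalBasis (Fin n) ℝ E)

theorem mul_cliffordVolume_of_anticommute {x : A} (hx : ∀ v, x * c v = -(c v * x)) :
    x * cliffordVolume c u = (-1 : ℤ) ^ n • (cliffordVolume c u * x) := by
  have h := mul_list_prod_of_anticommute (x := x) (l := List.ofFn fun i => c (u i)) fun y hy => by
    obtain ⟨i, rfl⟩ := List.mem_ofFn.mp hy
    exact hx _
  rwa [List.length_ofFn] at h

theorem IsClifford.pairwise_anticommute (hc : IsClifford c) :
    (List.ofFn fun i => c (u i)).Pairwise fun y z => y * z = -(z * y) :=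
  List.pairwise_ofFn.mpr fun _ _ hij =>
    hc.mul_eq_neg_of_inner_eq_zero (u.orthonormal.inner_eq_zero hij.ne)

theorem IsClifford.mul_cliffordVolume (hc : IsClifford c) (v : E) :
    c v * cliffordVolume c u = (-1 : ℤ) ^ (n + 1) • (cliffordVolume c u * c v) := by
  have h : LinearMap.mulRight ℝ (cliffordVolume c u) ∘ₗ c =
      (-1 : ℤ) ^ (n + 1) • (LinearMap.mulLeft ℝ (cliffordVolume c u) ∘ₗ c) := by
    refine u.toBasis.ext fun i => ?_
    have hi := mul_list_prod_of_mem (List.mem_ofFn.mpr ⟨i, rfl⟩) (hc.pairwise_anticommute u)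
    rwa [List.length_ofFn] at hi
  exact LinearMap.congr_fun h v

theorem IsClifford.cliffordVolume_mul_self (hc : IsClifford c) :
    cliffordVolume c u * cliffordVolume c u = (-1 : ℤ) ^ n.choose 2 • 1 := by
  have h := list_prod_mul_self_of_anticommute (l := List.ofFn fun i => c (u i)) (fun y hy => by
    obtain ⟨i, rfl⟩ := List.mem_ofFn.mp hy
    exact hc.mul_self_of_norm_eq_one (u.norm_eq_one i)) (hc.pairwise_anticommute u)
  rwa [List.length_ofFn] at h

end Volume

section Chirality

variable {E A : Type*} [NormedAddCommGroup E] [InnerProductSpace ℝ E] [Ring A] [Algebra ℝ A]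

/-- A representation of the Clifford algebra of `E ⊕ ℝ𝐩 ⊕ ℝ𝐪`, presented by the action `c` of `E`
together with the actions `a`, `d` of multiples of the isotropic vectors `𝐩`, `𝐪`, normalized so
that `a` and `d` act on `V ⊕ V` as the matrix units `(0 1; 0 0)` and `(0 0; 1 0)`. -/
structure IsCliffordFrame (c : E →ₗ[ℝ] A) (a d : A) : Prop where
  clifford : IsClifford c
  upper_sq : a * a = 0
  lower_sq : d * d = 0
  upper_lower : a * d + d * a = 1
  vec_upper : ∀ v, c v * a = -(a * c v)
  vec_lower : ∀ v, c v * d = -(d * c v)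

/-- A chirality operator of a Clifford frame: an involution anticommuting with all vectors. -/
structure IsChirality (c : E →ₗ[ℝ] A) (a d τ : A) : Prop where
  sq : τ * τ = 1
  vec : ∀ v, c v * τ = -(τ * c v)
  upper : a * τ = -(τ * a)
  lower : d * τ = -(τ * d)

/-- The projection `½(1 + τ)` onto the `+1`-eigenspace of an involution `τ`. -/
def involutionProj (τ : A) : A := (1 / 2 : ℝ) • (1 + τ)

variable {τ x : A}

theorem involutionProj_mul_self (hτ : τ * τ = 1) :
    involutionProj τ * involutionProj τ = involutionProj τ := by
  rw [involutionProj, smul_mul_smul_comm, mul_add, add_mul, add_mul, hτ]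
  simp only [one_mul, mul_one]
  module

theorem mul_involutionProj (hx : x * τ = -(τ * x)) :
    x * involutionProj τ = (1 - involutionProj τ) * x := by
  rw [involutionProj, mul_smul_comm, mul_add, hx, sub_mul, smul_mul_assoc, add_mul, mul_one,
    one_mul]
  module

theorem involutionProj_neg (τ : A) : involutionProj (-τ) = 1 - involutionProj τ := by
  simp only [involutionProj]
  module

variable {c : E →ₗ[ℝ] A} {a d : A}

namespace IsCliffordFrame

variable (h : IsCliffordFrame c a d)
include h

theorem upper_lower_upper : a * d * a = a := by
  calc a * d * a = a * (a * d + d * a) - a * a * d := by noncomm_ring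
    _ = a := by rw [h.upper_lower, h.upper_sq, mul_one, zero_mul, sub_zero]

theorem lower_upper_lower : d * a * d = d := by
  calc d * a * d = d * (a * d + d * a) - d * d * a := by noncomm_ring
    _ = d := by rw [h.upper_lower, h.lower_sq, mul_one, zero_mul, sub_zero]

theorem sign_mul_self : (a * d - d * a) * (a * d - d * a) = 1 := by
  calc (a * d - d * a) * (a * d - d * a)
      = a * d * a * d + d * a * d * a - a * (d * d) * a - d * (a * a) * d := by noncomm_ring
    _ = 1 := by
        rw [h.upper_lower_upper, h.lower_upper_lower, h.upper_sq, h.lower_sq, h.upper_lower]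
        noncomm_ring

theorem upper_mul_sign : a * (a * d - d * a) = -a := by
  rw [mul_sub, ← mul_assoc, ← mul_assoc, h.upper_sq, h.upper_lower_upper, zero_mul, zero_sub]

theorem sign_mul_upper : (a * d - d * a) * a = a := by
  rw [sub_mul, mul_assoc d, h.upper_sq, h.upper_lower_upper, mul_zero, sub_zero]

theorem lower_mul_sign : d * (a * d - d * a) = d := by
  rw [mul_sub, ← mul_assoc, ← mul_assoc, h.lower_sq, h.lower_upper_lower, zero_mul, sub_zero]

theorem sign_mul_lower : (a * d - d * a) * d = -d := by
  rw [sub_mul, mul_assoc a, h.lower_sq, h.lower_upper_lower, mul_zero, zero_sub]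

theorem commute_vec_sign (v : E) : Commute (c v) (a * d - d * a) := by
  have had : Commute (c v) (a * d) := by
    rw [commute_iff_eq, ← mul_assoc, h.vec_upper, neg_mul, mul_assoc, h.vec_lower, mul_neg, neg_neg,
      mul_assoc]
  have hda : Commute (c v) (d * a) := by
    rw [commute_iff_eq, ← mul_assoc, h.vec_lower, neg_mul, mul_assoc, h.vec_upper, mul_neg, neg_neg,
      mul_assoc]
  exact had.sub_right hda

variable {n : ℕ} (u : OrthonormalBasis (Fin n) ℝ E)

theorem commute_upper_cliffordVolume (hn : Even n) : Commute a (cliffordVolume c u) := by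
  have hanti : ∀ v, a * c v = -(c v * a) := fun v => by rw [h.vec_upper, neg_neg]
  rw [commute_iff_eq, mul_cliffordVolume_of_anticommute u hanti, hn.neg_one_pow, one_smul]

theorem commute_lower_cliffordVolume (hn : Even n) : Commute d (cliffordVolume c u) := by
  have hanti : ∀ v, d * c v = -(c v * d) := fun v => by rw [h.vec_lower, neg_neg]
  rw [commute_iff_eq, mul_cliffordVolume_of_anticommute u hanti, hn.neg_one_pow, one_smul]

theorem isChirality (hn : 4 ∣ n) :
    IsChirality c a d (cliffordVolume c u * (a * d - d * a)) := by
  have hn2 : Even n := even_iff_two_dvd.mpr (dvd_trans (by norm_num) hn)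
  have ha := h.commute_upper_cliffordVolume u hn2
  have hd := h.commute_lower_cliffordVolume u hn2
  refine ⟨?_, fun v => ?_, ?_, ?_⟩
  · have hsign : Commute (a * d - d * a) (cliffordVolume c u) :=
      (ha.mul_left hd).sub_left (hd.mul_left ha)
    have hchoose : Even (n.choose 2) := by
      obtain ⟨k, rfl⟩ := hn
      rw [Nat.choose_two_right, show 4 * k * (4 * k - 1) = 2 * (2 * (k * (4 * k - 1))) by ring,
        Nat.mul_div_cancel_left _ two_pos]
      exact even_two_mul _
    rw [hsign.mul_mul_mul_comm, h.clifford.cliffordVolume_mul_self, h.sign_mul_self,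
      hchoose.neg_one_pow, one_smul, mul_one]
  · rw [← mul_assoc, h.clifford.mul_cliffordVolume, hn2.add_one.neg_one_pow, neg_smul, one_smul,
      neg_mul, mul_assoc, (h.commute_vec_sign v).eq, mul_assoc]
  · rw [← mul_assoc, ha.eq, mul_assoc, mul_assoc, h.upper_mul_sign, h.sign_mul_upper, mul_neg]
  · rw [← mul_assoc, hd.eq, mul_assoc, mul_assoc, h.lower_mul_sign, h.sign_mul_lower, mul_neg,
      neg_neg]

end IsCliffordFrame

end Chirality

section LieHom

open CWAlgebra

variable {E : Type*} [NormedAddCommGroup E] [InnerProductSpace ℝ E] [FiniteDimensional ℝ E]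
  {L : Type*} [LieRing L] [LieAlgebra ℝ L] {b : CWForm E}

/-- The relations satisfied by the images `N e`, `X e`, `Z`, `K` of `e♭`, `e`, `𝐩`, `𝐪` under a
homomorphism from the Cahen-Wallach algebra `𝔤_b` to a Lie algebra. -/
structure SatisfiesRelations (b : CWForm E) (N X : E →ₗ[ℝ] L) (Z K : L) : Prop where
  dual_dual : ∀ v w, ⁅N v, N w⁆ = 0
  dual_vec : ∀ v w, ⁅N v, X w⁆ = b.form v w • Z
  dual_q : ∀ v, ⁅N v, K⁆ = X (b.endo v)
  vec_vec : ∀ v w, ⁅X v, X w⁆ = 0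
  q_vec : ∀ v, ⁅K, X v⁆ = N v
  p_dual : ∀ v, ⁅Z, N v⁆ = 0
  p_vec : ∀ v, ⁅Z, X v⁆ = 0
  p_q : ⁅Z, K⁆ = 0

theorem SatisfiesRelations.exists_lieHom {N X : E →ₗ[ℝ] L} {Z K : L}
    (h : SatisfiesRelations b N X Z K) :
    ∃ ρ : CWAlgebra b →ₗ⁅ℝ⁆ L, (∀ e, ρ (ofDual (flat E e)) = N e) ∧ (∀ e, ρ (ofVec e) = X e) ∧
      ρ (p b) = Z ∧ ρ (q b) = K := by
  let f : CWAlgebra b →ₗ[ℝ] L :=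
    { toFun := fun x => N ((flat E).symm x.dual) + X x.vec + x.pc • Z + x.qc • K
      map_add' := fun x y => by
        simp only [dual_add, vec_add, pc_add, qc_add, map_add, add_smul]
        abel
      map_smul' := fun r x => by
        simp only [dual_smul, vec_smul, pc_smul, qc_smul, map_smul, mul_smul, smul_add,
          RingHom.id_apply] }
  have hf : ∀ x, f x = N ((flat E).symm x.dual) + X x.vec + x.pc • Z + x.qc • K := fun _ => rfl
  refine ⟨{ f with map_lie' := @fun x y => ?_ }, fun e => ?_, fun e => ?_, ?_, ?_⟩
  · have hXN : ∀ v w, ⁅X v, N w⁆ = -(b.form w v • Z) := fun v w => by rw [← lie_skew, h.dual_vec]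
    have hKN : ∀ v, ⁅K, N v⁆ = -X (b.endo v) := fun v => by rw [← lie_skew, h.dual_q]
    have hXK : ∀ v, ⁅X v, K⁆ = -N v := fun v => by rw [← lie_skew, h.q_vec]
    have hNZ : ∀ v, ⁅N v, Z⁆ = 0 := fun v => by rw [← lie_skew, h.p_dual, neg_zero]
    have hXZ : ∀ v, ⁅X v, Z⁆ = 0 := fun v => by rw [← lie_skew, h.p_vec, neg_zero]
    have hKZ : ⁅K, Z⁆ = 0 := by rw [← lie_skew, h.p_q, neg_zero]
    change f ⁅x, y⁆ = ⁅f x, f y⁆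
    simp only [hf, add_lie, lie_add, smul_lie, lie_smul, h.dual_dual, h.dual_vec, h.dual_q,
      h.vec_vec, h.q_vec, h.p_dual, h.p_vec, h.p_q, hXN, hKN, hXK, hNZ, hXZ, hKZ, lie_self,
      smul_zero, bracket_def, dual_mk, vec_mk, pc_mk, qc_mk, map_sub, map_smul,
      LinearEquiv.symm_apply_apply, sub_smul, zero_smul, smul_neg]
    module
  all_goals
    refine (hf _).trans ?_
    simp only [ofDual, ofVec, p, q, dual_mk, vec_mk, pc_mk, qc_mk, map_zero, zero_smul, one_smul,
      zero_add, add_zero, LinearEquiv.symm_apply_apply]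

end LieHom

section HalfSpin

variable {E A : Type*} [NormedAddCommGroup E] [InnerProductSpace ℝ E] [Ring A] [Algebra ℝ A]
  {c : E →ₗ[ℝ] A} {a d τ : A}

theorem lie_involutionProj_mul {x y : A} (hτ : τ * τ = 1) (hx : x * τ = -(τ * x))
    (hy : y * τ = -(τ * y)) : ⁅involutionProj τ * x, involutionProj τ * y⁆ = 0 := by
  have hθ : involutionProj τ * (1 - involutionProj τ) = 0 := by
    rw [mul_sub, mul_one, involutionProj_mul_self hτ, sub_self]
  have hzero : ∀ {x : A}, x * τ = -(τ * x) → ∀ z,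
      involutionProj τ * x * (involutionProj τ * z) = 0 := fun {x} hx z => by
    calc involutionProj τ * x * (involutionProj τ * z)
        = involutionProj τ * (x * involutionProj τ) * z := by noncomm_ring
      _ = 0 := by rw [mul_involutionProj hx, ← mul_assoc, hθ, zero_mul, zero_mul]
  rw [LieRing.of_associative_ring_bracket, hzero hx, hzero hy, sub_self]

theorem IsChirality.upper_vec_involutionProj (hτ : IsChirality c a d τ) (v : E) :
    a * c v * involutionProj τ = involutionProj τ * (a * c v) := by
  calc a * c v * involutionProj τ = a * c v - a * involutionProj τ * c v := by
        rw [mul_assoc, mul_involutionProj (hτ.vec v)]; noncomm_ring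
    _ = involutionProj τ * (a * c v) := by
        rw [mul_involutionProj hτ.upper]; noncomm_ring

theorem IsChirality.lie_upper_vec_involutionProj_mul (hτ : IsChirality c a d τ) (v : E) (x : A) :
    ⁅a * c v, involutionProj τ * x⁆ = involutionProj τ * ⁅a * c v, x⁆ := by
  rw [LieRing.of_associative_ring_bracket, ← mul_assoc, hτ.upper_vec_involutionProj,
    LieRing.of_associative_ring_bracket]
  noncomm_ring

namespace IsCliffordFrame

variable (h : IsCliffordFrame c a d)
include h

theorem upper_vec_upper (v : E) : a * c v * a = 0 := by
  rw [mul_assoc, h.vec_upper, mul_neg, ← mul_assoc, h.upper_sq, zero_mul, neg_zero]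

theorem lie_upper_vec_upper_vec (v w : E) : ⁅a * c v, a * c w⁆ = 0 := by
  simp only [LieRing.of_associative_ring_bracket, ← mul_assoc, h.upper_vec_upper, zero_mul,
    sub_self]

theorem lie_upper_vec_upper (v : E) : ⁅a * c v, a⁆ = 0 := by
  rw [LieRing.of_associative_ring_bracket, h.upper_vec_upper, ← mul_assoc, h.upper_sq, zero_mul,
    sub_zero]

variable (hτ : IsChirality c a d τ)
include hτ

theorem lie_upper_vec_involutionProj_vec (v w : E) :
    ⁅a * c v, involutionProj τ * c w⁆ = (2 * inner ℝ v w : ℝ) • (involutionProj τ * a) := by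
  have hvw : ⁅a * c v, c w⁆ = (2 * inner ℝ v w : ℝ) • a := by
    calc ⁅a * c v, c w⁆ = a * (c v * c w) - c w * a * c v := by
          rw [LieRing.of_associative_ring_bracket]; noncomm_ring
      _ = a * (c v * c w + c w * c v) := by rw [h.vec_upper]; noncomm_ring
      _ = _ := by rw [h.clifford, mul_smul_comm, mul_one]
  rw [hτ.lie_upper_vec_involutionProj_mul, hvw, mul_smul_comm]

theorem lie_upper_vec_involutionProj_lower (v : E) :
    ⁅a * c v, involutionProj τ * d⁆ = -(involutionProj τ * c v) := by
  have hv : ⁅a * c v, d⁆ = -c v := by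
    calc ⁅a * c v, d⁆ = a * (c v * d) - d * a * c v := by
          rw [LieRing.of_associative_ring_bracket]; noncomm_ring
      _ = -((a * d + d * a) * c v) := by rw [h.vec_lower]; noncomm_ring
      _ = -c v := by rw [h.upper_lower, one_mul]
  rw [hτ.lie_upper_vec_involutionProj_mul, hv, mul_neg]

theorem lie_involutionProj_upper_upper_vec (v : E) : ⁅involutionProj τ * a, a * c v⁆ = 0 := by
  rw [← lie_skew, hτ.lie_upper_vec_involutionProj_mul, h.lie_upper_vec_upper, mul_zero, neg_zero]

theorem lie_upper_involutionProj_vec (v : E) : ⁅a, involutionProj τ * c v⁆ = a * c v := by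
  calc ⁅a, involutionProj τ * c v⁆
      = a * involutionProj τ * c v - involutionProj τ * (c v * a) := by
        rw [LieRing.of_associative_ring_bracket]; noncomm_ring
    _ = a * c v := by rw [mul_involutionProj hτ.upper, h.vec_upper]; noncomm_ring

theorem lie_involutionProj_upper_upper : ⁅involutionProj τ * a, a⁆ = 0 := by
  rw [LieRing.of_associative_ring_bracket, mul_assoc, h.upper_sq, ← mul_assoc,
    mul_involutionProj hτ.upper, mul_assoc, h.upper_sq, mul_zero, mul_zero, sub_zero]

theorem involutionProj_mul_upper_ne_zero [Nontrivial A] [Nontrivial E] :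
    involutionProj τ * a ≠ 0 := by
  intro h0
  obtain ⟨v, hv⟩ := exists_norm_eq E zero_le_one
  have ha : a * c v = 0 := by
    calc a * c v = involutionProj τ * a * c v - (1 - involutionProj τ) * c v * a := by
          rw [mul_assoc (1 - _), h.vec_upper]; noncomm_ring
      _ = 0 := by
          rw [← mul_involutionProj (hτ.vec v), mul_assoc (c v), h0, zero_mul, mul_zero, sub_zero]
  have ha0 : a = 0 := by
    rw [← mul_one a, ← h.clifford.mul_self_of_norm_eq_one hv, ← mul_assoc, ha, zero_mul]
  refine one_ne_zero (α := A) ?_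
  rw [← h.upper_lower, ha0, zero_mul, mul_zero, add_zero]

variable [FiniteDimensional ℝ E] {b : CWForm E} {r : ℝ}

theorem satisfiesRelations (hB : b.endo = r • LinearMap.id) :
    SatisfiesRelations b
      (√2 • LinearMap.mulLeft ℝ a ∘ₗ c ∘ₗ b.endo)
      (√2 • LinearMap.mulLeft ℝ (involutionProj τ) ∘ₗ c)
      ((4 : ℝ) • (involutionProj τ * a)) (r • a - involutionProj τ * d) := by
  have hBv : ∀ v, b.endo v = r • v := fun v => by rw [hB]; rfl
  have hform : ∀ v w, b.form v w = r * inner ℝ v w := fun v w => by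
    rw [b.form_eq, scalarE_apply, neg_neg, hBv, real_inner_smul_left]
  constructor
  case dual_vec =>
    intro v w
    simp only [LinearMap.smul_apply, LinearMap.comp_apply, LinearMap.mulLeft_apply, hBv, hform,
      map_smul, smul_lie, lie_smul, h.lie_upper_vec_involutionProj_vec hτ, smul_smul]
    congr 1
    linear_combination (2 * r * inner ℝ v w) * Real.mul_self_sqrt (zero_le_two (α := ℝ))
  all_goals
    intros
    simp only [LinearMap.smul_apply, LinearMap.comp_apply, LinearMap.mulLeft_apply, hBv,
      map_smul, smul_lie, lie_smul, lie_sub, sub_lie, h.lie_upper_vec_upper_vec,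
      h.lie_upper_vec_upper, h.lie_upper_vec_involutionProj_lower hτ,
      h.lie_upper_involutionProj_vec hτ, h.lie_involutionProj_upper_upper hτ,
      h.lie_involutionProj_upper_upper_vec hτ, lie_involutionProj_mul hτ.sq, hτ.vec, hτ.upper,
      hτ.lower, smul_zero, sub_zero, sub_self, zero_sub, neg_neg, smul_neg, smul_smul,
      mul_comm r (√2)]

end IsCliffordFrame

end HalfSpin

section Spin

open CWAlgebra

variable {E A : Type*} [NormedAddCommGroup E] [InnerProductSpace ℝ E] [Ring A] [Algebra ℝ A]
  (φ : ClM E →ₐ[ℝ] A)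

/-- The action of `E ⊆ 𝔪` in a representation of `Cl(𝔪)`. -/
def vecMap : E →ₗ[ℝ] A :=
  φ.toLinearMap ∘ₗ inM ∘ₗ LinearMap.inl ℝ E (ℝ × ℝ)

/-- The action of `𝐩 / (2√2)`, which is the matrix unit `(0 1; 0 0)` in the model `V ⊕ V`. -/
def upperUnit : A :=
  (1 / (2 * √2) : ℝ) • φ (inM vecP)

/-- The action of `-√2 𝐪`, which is the matrix unit `(0 0; 1 0)` in the model `V ⊕ V`. -/
def lowerUnit : A :=
  (-√2) • φ (inM (0, 0, 1))

theorem map_inM_mul_add (x y : Minkowski E) :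
    φ (inM x) * φ (inM y) + φ (inM y) * φ (inM x) = (-2 * scalarM E x y) • 1 := by
  have hxy : inM x * inM y + inM y * inM x = algebraMap ℝ (ClM E) (-2 * scalarM E x y) := by
    refine (CliffordAlgebra.ι_mul_ι_add_swap (Q := -(scalarM E).toQuadraticMap) x y).trans ?_
    rw [FunLike.coe_neg, QuadraticMap.polar_neg, LinearMap.BilinMap.polar_toQuadraticMap]
    congr 1
    simp only [scalarM, LinearMap.mk₂_apply, scalarE_apply, real_inner_comm]
    ring
  rw [← map_mul φ, ← map_mul φ, ← map_add, hxy, AlgHom.commutes, Algebra.algebraMap_eq_smul_one]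

theorem map_inM_mul_eq_neg {x y : Minkowski E} (h : scalarM E x y = 0) :
    φ (inM x) * φ (inM y) = -(φ (inM y) * φ (inM x)) := by
  rw [eq_neg_iff_add_eq_zero, map_inM_mul_add, h, mul_zero, zero_smul]

theorem map_inM_mul_self_eq_zero {x : Minkowski E} (h : scalarM E x x = 0) :
    φ (inM x) * φ (inM x) = 0 := by
  have hx := map_inM_mul_add φ x x
  rw [h, mul_zero, zero_smul, ← two_smul ℝ] at hx
  exact (smul_eq_zero.mp hx).resolve_left two_ne_zero

theorem isCliffordFrame : IsCliffordFrame (vecMap φ) (upperUnit φ) (lowerUnit φ) where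
  clifford v w := by
    refine (map_inM_mul_add φ (v, 0, 0) (w, 0, 0)).trans ?_
    simp [scalarM]
  upper_sq := by
    rw [upperUnit, smul_mul_smul_comm, map_inM_mul_self_eq_zero φ (by simp [scalarM, vecP]),
      smul_zero]
  lower_sq := by
    rw [lowerUnit, smul_mul_smul_comm, map_inM_mul_self_eq_zero φ (by simp [scalarM]), smul_zero]
  upper_lower := by
    have h2 : 1 / (2 * √2) * -√2 = -1 / 2 := by field_simp
    rw [upperUnit, lowerUnit, smul_mul_smul_comm, smul_mul_smul_comm, mul_comm (-√2), ← smul_add,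
      map_inM_mul_add, h2, smul_smul]
    simp [scalarM, vecP]
  vec_upper v := by
    rw [upperUnit, mul_smul_comm, smul_mul_assoc, ← smul_neg]
    congr 1
    exact map_inM_mul_eq_neg φ (by simp [scalarM, vecP])
  vec_lower v := by
    rw [lowerUnit, mul_smul_comm, smul_mul_assoc, ← smul_neg]
    congr 1
    exact map_inM_mul_eq_neg φ (by simp [scalarM])

theorem map_wedge_vecP (v : E) :
    φ (wedge vecP (v, 0, 0)) = √2 • (upperUnit φ * vecMap φ v) := by
  have hvp : φ (inM (v, 0, 0)) * φ (inM vecP) = -(φ (inM vecP) * φ (inM (v, 0, 0))) :=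
    map_inM_mul_eq_neg φ (by simp [scalarM, vecP])
  have h2 : √2 * (1 / (2 * √2)) = 1 / 4 + 1 / 4 := by field_simp; norm_num
  calc φ (wedge vecP (v, 0, 0)) = (1 / 4 + 1 / 4 : ℝ) • (φ (inM vecP) * φ (inM (v, 0, 0))) := by
        simp only [wedge, map_smul, map_sub, map_mul, hvp]
        module
    _ = √2 • (upperUnit φ * vecMap φ v) := by
        rw [← h2, mul_smul, upperUnit, smul_mul_assoc]
        rfl

variable [FiniteDimensional ℝ E] {b : CWForm E}

theorem CWForm.endo_surjective (b : CWForm E) : Function.Surjective b.endo := by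
  rw [← LinearMap.injective_iff_surjective, ← LinearMap.ker_eq_bot, LinearMap.ker_eq_bot']
  refine fun v hv => b.nondegenerate.1 v fun w => ?_
  rw [b.form_eq, hv, map_zero, LinearMap.zero_apply, neg_zero]

theorem lie_ofDual_flat_q (v : E) :
    ⁅(ofDual (flat E v) : CWAlgebra b), q b⁆ = ofVec (b.endo v) := by
  ext1 <;> simp [bracket_def, ofDual, ofVec, q]

theorem lie_ofDual_flat_ofVec (v w : E) :
    ⁅(ofDual (flat E v) : CWAlgebra b), ofVec w⁆ = b.form v w • p b := by
  ext1 <;> simp [bracket_def, ofDual, ofVec, p]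

theorem lie_q_ofVec (v : E) : ⁅q b, (ofVec v : CWAlgebra b)⁆ = ofDual (flat E v) := by
  ext1 <;> simp [bracket_def, ofDual, ofVec, q]

theorem lie_p_q : ⁅p b, q b⁆ = 0 := by
  ext1 <;> simp [bracket_def, p, q]

theorem exists_endo_eq_smul_id (ρ : CWAlgebra b →ₗ⁅ℝ⁆ A)
    (hspin : ∀ e, ρ (ofDual (flat E e)) = φ (wedge vecP (b.endo e, 0, 0))) (hp : ρ (p b) ≠ 0) :
    ∃ r : ℝ, b.endo = r • LinearMap.id := by
  have h := isCliffordFrame φ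
  have hN : ∀ v, (√2 • upperUnit φ) * vecMap φ (b.endo v) = ρ (ofDual (flat E v)) := fun v => by
    rw [smul_mul_assoc, ← map_wedge_vecP, hspin]
  refine exists_eq_smul_id_of_lie_lie (P := √2 • upperUnit φ) (K := ρ (q b)) h.clifford ?_
    (fun v => ?_) hp ?_ (fun v' => ?_) (fun v' => ?_)
  · rw [smul_mul_smul_comm, h.upper_sq, smul_zero]
  · rw [mul_smul_comm, h.vec_upper, smul_mul_assoc, smul_neg]
  · rw [commute_iff_lie_eq, ← LieHom.map_lie, lie_p_q, map_zero]
  all_goals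
    obtain ⟨v, rfl⟩ := b.endo_surjective v'
    rw [hN, ← LieHom.map_lie, ← LieHom.map_lie, lie_ofDual_flat_q]
  · rw [lie_ofDual_flat_ofVec, map_smul, b.form_eq, scalarE_apply, neg_neg]
  · rw [lie_q_ofVec, hN]

variable {n : ℕ} (u : OrthonormalBasis (Fin n) ℝ E)

/-- The chirality operator of a representation of `Cl(𝔪)`: the volume element of `E` followed by the
sign operator which is `(1 0; 0 -1)` in the model `V ⊕ V`. -/
def chirality : A :=
  cliffordVolume (vecMap φ) u * (upperUnit φ * lowerUnit φ - lowerUnit φ * upperUnit φ)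

theorem exists_spinRep [Nontrivial A] [Nontrivial E] (hn : 4 ∣ n) {r : ℝ}
    (hB : b.endo = r • LinearMap.id) :
    ∃ ρ : CWAlgebra b →ₗ⁅ℝ⁆ A,
      (∀ e, ρ (ofDual (flat E e)) = φ (wedge vecP (b.endo e, 0, 0))) ∧ ρ (p b) ≠ 0 ∧
      (∀ e, ρ (ofVec e) = √2 • (involutionProj (chirality φ u) * vecMap φ e)) ∧
      ρ (p b) = (4 : ℝ) • (involutionProj (chirality φ u) * upperUnit φ) ∧
      ρ (q b) = r • upperUnit φ - involutionProj (chirality φ u) * lowerUnit φ := by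
  have h := isCliffordFrame φ
  have hτ : IsChirality (vecMap φ) (upperUnit φ) (lowerUnit φ) (chirality φ u) :=
    h.isChirality u hn
  obtain ⟨ρ, hdual, hvec, hp, hq⟩ := (h.satisfiesRelations hτ hB).exists_lieHom
  refine ⟨ρ, fun e => ?_, ?_, hvec, hp, hq⟩
  · rw [hdual, map_wedge_vecP]
    rfl
  · rw [hp]
    exact smul_ne_zero four_ne_zero (h.involutionProj_mul_upper_ne_zero hτ)

end Spin

section Model

open CWAlgebra

variable {V : Type*} [AddCommGroup V] [Module ℝ V]

theorem block_mul (a b c d a' b' c' d' : End ℝ V) : block a b c d * block a' b' c' d' =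
    block (a * a' + b * c') (a * b' + b * d') (c * a' + d * c') (c * b' + d * d') := by
  ext x <;> simp

theorem block_smul (r : ℝ) (a b c d : End ℝ V) :
    r • block a b c d = block (r • a) (r • b) (r • c) (r • d) := by
  ext x <;> simp

theorem block_add (a b c d a' b' c' d' : End ℝ V) : block a b c d + block a' b' c' d' =
    block (a + a') (b + b') (c + c') (d + d') := by
  ext x <;> simp

theorem block_sub (a b c d a' b' c' d' : End ℝ V) : block a b c d - block a' b' c' d' =
    block (a - a') (b - b') (c - c') (d - d') := by
  ext x <;> simp [sub_eq_add_neg]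

theorem block_one : block 1 0 0 1 = (1 : End ℝ (V × V)) := by
  ext x <;> simp

theorem list_prod_block_neg (l : List (End ℝ V)) :
    (l.map fun x => block (-x) 0 0 x).prod =
      block ((-1 : ℤ) ^ l.length • l.prod) 0 0 l.prod := by
  induction l with
  | nil => simp only [List.map_nil, List.prod_nil, List.length_nil, pow_zero, one_smul, block_one]
  | cons x l ih =>
    simp only [List.map_cons, List.prod_cons, ih, block_mul, mul_zero, zero_mul, add_zero, zero_add,
      List.length_cons, pow_succ', neg_mul, one_mul, neg_smul, mul_smul_comm, smul_neg, smul_zero]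

theorem involutionProj_block (x y : End ℝ V) :
    involutionProj (block x 0 0 y) = block (involutionProj x) 0 0 (involutionProj y) := by
  simp only [involutionProj, ← block_one, block_add, block_smul, add_zero, smul_zero]

variable {E : Type*} [NormedAddCommGroup E] [InnerProductSpace ℝ E] (γ : ClE E →ₐ[ℝ] End ℝ V)

theorem isClifford_inE : IsClifford (inE : E →ₗ[ℝ] ClE E) := fun v w => by
  refine (CliffordAlgebra.ι_mul_ι_add_swap (Q := -(scalarE E).toQuadraticMap) v w).trans ?_
  rw [FunLike.coe_neg, QuadraticMap.polar_neg, LinearMap.BilinMap.polar_toQuadraticMap,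
    Algebra.algebraMap_eq_smul_one, scalarE_apply, scalarE_apply, real_inner_comm]
  congr 1
  ring

theorem model_inM (v : Minkowski E) : model γ (inM v) = modelVec γ v :=
  CliffordAlgebra.lift_ι_apply _ _ v

theorem vecMap_model (v : E) : vecMap (model γ) v = block (-γ (inE v)) 0 0 (γ (inE v)) := by
  refine (model_inM γ _).trans ?_
  simp [modelVec]

theorem upperUnit_model : upperUnit (model γ) = block 0 1 0 0 := by
  have h2 : 1 / (2 * √2) * (2 * √2) = 1 := one_div_mul_cancel (by positivity)
  rw [upperUnit, model_inM]
  simp [modelVec, vecP, block_smul, smul_smul, -one_div, h2]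

theorem lowerUnit_model : lowerUnit (model γ) = block 0 0 1 0 := by
  rw [lowerUnit, model_inM]
  ext x <;> simp [modelVec, smul_smul]

theorem cliffordVolume_vecMap_model {n : ℕ} (hn : Even n) (u : OrthonormalBasis (Fin n) ℝ E) :
    cliffordVolume (vecMap (model γ)) u =
      block (γ (cliffordVolume inE u)) 0 0 (γ (cliffordVolume inE u)) := by
  have h := list_prod_block_neg (List.ofFn fun i => γ (inE (u i)))
  rw [List.length_ofFn, hn.neg_one_pow, one_smul, List.map_ofFn] at h
  simp only [cliffordVolume, vecMap_model, map_list_prod, List.map_ofFn]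
  exact h

theorem involutionProj_chirality_model {n : ℕ} (hn : Even n) (u : OrthonormalBasis (Fin n) ℝ E) :
    involutionProj (chirality (model γ) u) =
      block (involutionProj (γ (cliffordVolume inE u))) 0 0
        (involutionProj (-γ (cliffordVolume inE u))) := by
  rw [chirality, cliffordVolume_vecMap_model γ hn, upperUnit_model, lowerUnit_model,
    ← involutionProj_block]
  simp [block_mul, block_sub]

theorem map_inE_mul_map_cliffordVolume {n : ℕ} (hn : Even n) (u : OrthonormalBasis (Fin n) ℝ E)
    (v : E) : γ (inE v) * γ (cliffordVolume inE u) = -(γ (cliffordVolume inE u) * γ (inE v)) := by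
  rw [← map_mul, isClifford_inE.mul_cliffordVolume, hn.add_one.neg_one_pow, neg_smul, one_smul,
    map_neg, map_mul]

theorem apply_mem_of_forall_ι {M S : Type*} [AddCommGroup M] [Module ℝ M] [AddCommGroup S]
    [Module ℝ S] {Q : QuadraticForm ℝ M} (ρ : CliffordAlgebra Q →ₐ[ℝ] End ℝ S) {W : Submodule ℝ S}
    (h : ∀ v, ∀ x ∈ W, ρ (CliffordAlgebra.ι Q v) x ∈ W) (z : CliffordAlgebra Q) :
    ∀ x ∈ W, ρ z x ∈ W := by
  induction z using CliffordAlgebra.induction with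
  | algebraMap r =>
    exact fun x hx => by
      rw [AlgHom.commutes, Module.algebraMap_end_apply]
      exact W.smul_mem r hx
  | ι v => exact h v
  | mul y z hy hz =>
    exact fun x hx => by
      rw [map_mul]
      exact hy _ (hz x hx)
  | add y z hy hz =>
    exact fun x hx => by
      rw [map_add]
      exact W.add_mem (hy x hx) (hz x hx)

theorem isIrreducible_model {γ : ClE E →ₐ[ℝ] End ℝ V} (hγ : IsIrreducible γ) :
    IsIrreducible (model γ) := by
  obtain ⟨_, hirr⟩ := hγ
  refine ⟨inferInstance, fun W hW => ?_⟩
  have hupper : ∀ x ∈ W, (x.2, 0) ∈ W := fun x hx => by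
    have h := W.smul_mem (1 / (2 * √2)) (hW (inM vecP) x hx)
    rw [← LinearMap.smul_apply, ← upperUnit, upperUnit_model] at h
    simpa only [block_apply, LinearMap.zero_apply, Module.End.one_apply, zero_add, add_zero] using h
  have hlower : ∀ x ∈ W, (0, x.1) ∈ W := fun x hx => by
    have h := W.smul_mem (-√2) (hW (inM (0, 0, 1)) x hx)
    rw [← LinearMap.smul_apply, ← lowerUnit, lowerUnit_model] at h
    simpa only [block_apply, LinearMap.zero_apply, Module.End.one_apply, zero_add, add_zero] using h
  have hinv : ∀ v, ∀ x ∈ W.comap (LinearMap.inl ℝ V V),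
      γ (inE v) x ∈ W.comap (LinearMap.inl ℝ V V) := fun v x hx => by
    have h : vecMap (model γ) v (x, 0) ∈ W := hW _ _ hx
    rw [vecMap_model] at h
    simpa using W.neg_mem h
  rcases hirr _ (apply_mem_of_forall_ι γ hinv) with h | h
  · refine Or.inl ((Submodule.eq_bot_iff W).mpr fun x hx => Prod.ext ?_ ?_)
    · exact (Submodule.eq_bot_iff _).mp h _ (hupper _ (hlower x hx))
    · exact (Submodule.eq_bot_iff _).mp h _ (hupper x hx)
  · refine Or.inr ((Submodule.eq_top_iff').mpr fun x => ?_)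
    have hinl : ∀ y, (y, (0 : V)) ∈ W := fun y => (Submodule.eq_top_iff'.mp h y :)
    simpa using W.add_mem (hinl x.1) (hlower _ (hinl x.2))

theorem exists_spinRep_model [FiniteDimensional ℝ E] [Nontrivial E] [Nontrivial V] {n : ℕ}
    (hn : 4 ∣ n) (u : OrthonormalBasis (Fin n) ℝ E) {b : CWForm E} {r : ℝ}
    (hB : b.endo = r • LinearMap.id) :
    ∃ ρ : CWAlgebra b →ₗ⁅ℝ⁆ End ℝ (V × V), IsSpin (model γ) ρ ∧ ρ (p b) ≠ 0 ∧
      (∀ e, ρ (ofDual (flat E e)) = √2 • block 0 (γ (inE (b.endo e))) 0 0) ∧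
      (∀ e, ρ (ofVec e) =
        √2 • block (-(γ (inE e) * involutionProj (-γ (cliffordVolume inE u)))) 0 0
          (γ (inE e) * involutionProj (γ (cliffordVolume inE u)))) ∧
      ρ (p b) = (4 : ℝ) • block 0 (involutionProj (γ (cliffordVolume inE u))) 0 0 ∧
      ρ (q b) = block 0 (r • 1) (-involutionProj (-γ (cliffordVolume inE u))) 0 := by
  have hn2 : Even n := even_iff_two_dvd.mpr (dvd_trans (by norm_num) hn)
  obtain ⟨ρ, hspin, hp0, hvec, hp, hq⟩ := exists_spinRep (model γ) u hn hB
  rw [involutionProj_chirality_model γ hn2, upperUnit_model] at hp hq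
  have hanti := map_inE_mul_map_cliffordVolume γ hn2 u
  refine ⟨ρ, hspin, hp0, fun e => ?_, fun e => ?_, ?_, ?_⟩
  · rw [hspin, map_wedge_vecP, upperUnit_model, vecMap_model]
    simp [block_mul]
  · rw [hvec, involutionProj_chirality_model γ hn2, vecMap_model, involutionProj_neg,
      mul_involutionProj (hanti e), mul_sub, mul_involutionProj (hanti e)]
    simp [block_mul, sub_mul]
  · rw [hp]
    simp [block_mul]
  · rw [hq, lowerUnit_model]
    simp [block_mul, block_sub, block_smul]

end Model

section Trace

variable {K W : Type*} [Field K] [CharZero K] [AddCommGroup W] [Module K W] [FiniteDimensional K W]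
  [Nontrivial W] {B : End K W}

theorem exists_eq_smul_id_iff_of_trace_eq_finrank
    (h : LinearMap.trace K W (B ∘ₗ B) = finrank K W) :
    (∃ r : K, B = r • LinearMap.id) ↔ B = LinearMap.id ∨ B = -LinearMap.id := by
  refine ⟨?_, ?_⟩
  · rintro ⟨r, rfl⟩
    have hr : r * r = 1 := by
      rw [LinearMap.smul_comp, LinearMap.comp_smul, LinearMap.id_comp, map_smul, map_smul,
        LinearMap.trace_id, smul_smul, smul_eq_mul] at h
      exact (mul_eq_right₀ (Nat.cast_ne_zero.mpr finrank_pos.ne')).mp h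
    refine (mul_self_eq_one_iff.mp hr).imp ?_ ?_ <;> rintro rfl
    · exact one_smul _ _
    · exact neg_one_smul _ _
  · rintro (rfl | rfl)
    · exact ⟨1, (one_smul _ _).symm⟩
    · exact ⟨-1, (neg_one_smul _ _).symm⟩

end Trace

section Spinors

variable {E V : Type*} [NormedAddCommGroup E] [InnerProductSpace ℝ E] [AddCommGroup V] [Module ℝ V]
  (γ : ClE E →ₐ[ℝ] End ℝ V) (u : OrthonormalBasis (Fin 8) ℝ E)

theorem semiProj_one : semiProj γ u 1 = involutionProj (γ (cliffordVolume inE u)) := by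
  rw [semiProj, one_smul]
  rfl

theorem semiProj_neg_one : semiProj γ u (-1) = involutionProj (-γ (cliffordVolume inE u)) := by
  rw [semiProj, neg_one_smul]
  rfl

end Spinors

end

end CahenWallach

open CahenWallach CahenWallach.CWAlgebra in
theorem theorem4p5_general
    {E : Type*} [NormedAddCommGroup E] [InnerProductSpace ℝ E] [FiniteDimensional ℝ E]
    [Nontrivial E] {n : ℕ} (hn : 4 ∣ n) (hdim : Module.finrank ℝ E = n) (b : CWForm E) :
    (∀ (S : Type*) [AddCommGroup S] [Module ℝ S] [Nontrivial S]
      (ρspin : ClM E →ₐ[ℝ] Module.End ℝ S),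
        HasNonzeroChargeSpinRep b ρspin ↔ ∃ r : ℝ, b.endo = r • LinearMap.id) ∧
    (∀ (V : Type*) [AddCommGroup V] [Module ℝ V] (γ : ClE E →ₐ[ℝ] Module.End ℝ V),
      (IsIrreducible γ → IsIrreducible (model γ)) ∧
      ∀ [Nontrivial V] (u : OrthonormalBasis (Fin n) ℝ E) (r : ℝ), b.endo = r • LinearMap.id →
        ∃ ρ : CWAlgebra b →ₗ⁅ℝ⁆ Module.End ℝ (V × V),
          IsSpin (model γ) ρ ∧ ρ (p b) ≠ 0 ∧
          (∀ e : E, ρ (ofDual (flat E e)) = √2 • block 0 (γ (inE (b.endo e))) 0 0) ∧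
          (∀ e : E, ρ (ofVec e) =
            √2 • block (-(γ (inE e) * involutionProj (-γ (cliffordVolume inE u)))) 0 0
              (γ (inE e) * involutionProj (γ (cliffordVolume inE u)))) ∧
          ρ (p b) = (4 : ℝ) • block 0 (involutionProj (γ (cliffordVolume inE u))) 0 0 ∧
          ρ (q b) = block 0 (r • 1) (-involutionProj (-γ (cliffordVolume inE u))) 0) := by
  refine ⟨fun S _ _ _ ρspin => ⟨?_, ?_⟩, fun V _ _ γ =>
    ⟨isIrreducible_model, fun u r hB => exists_spinRep_model γ hn u hB⟩⟩
  · rintro ⟨ρ, hspin, hp⟩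
    exact exists_endo_eq_smul_id ρspin ρ hspin hp
  · rintro ⟨r, hB⟩
    let u := (stdOrthonormalBasis ℝ E).reindex (finCongr hdim)
    obtain ⟨ρ, hspin, hp, -⟩ := exists_spinRep ρspin u hn hB
    exact ⟨ρ, hspin, hp⟩

open CahenWallach CahenWallach.CWAlgebra in
theorem theorem4p5
    {E : Type*} [NormedAddCommGroup E] [InnerProductSpace ℝ E] [FiniteDimensional ℝ E]
    (hdim : Module.finrank ℝ E = 8) (b : CWForm E)
    (hnorm : LinearMap.trace ℝ E (b.endo ∘ₗ b.endo) = 8) :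
    (∀ (S : Type*) [AddCommGroup S] [Module ℝ S] (ρspin : ClM E →ₐ[ℝ] Module.End ℝ S),
      IsIrreducible ρspin →
        (HasNonzeroChargeSpinRep b ρspin ↔
          b.endo = LinearMap.id ∨ b.endo = -LinearMap.id)) ∧
    (∀ (V : Type*) [AddCommGroup V] [Module ℝ V] (γ : ClE E →ₐ[ℝ] Module.End ℝ V),
      IsIrreducible γ →
        IsIrreducible (model γ) ∧
        ∀ (u : OrthonormalBasis (Fin 8) ℝ E) (ε : ℝ), ε = 1 ∨ ε = -1 →
          b.endo = ε • LinearMap.id →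
          ∃ ρ : CWAlgebra b →ₗ⁅ℝ⁆ Module.End ℝ (V × V),
            IsSpin (model γ) ρ ∧ ρ (p b) ≠ 0 ∧
            (∀ e : E, ρ (ofDual (flat E e)) = √2 • block 0 (γ (inE (b.endo e))) 0 0) ∧
            (∀ e : E, ρ (ofVec e) =
              √2 • block (-(γ (inE e) * semiProj γ u (-1))) 0 0 (γ (inE e) * semiProj γ u 1)) ∧
            ρ (p b) = (4 : ℝ) • block 0 (semiProj γ u 1) 0 0 ∧
            ρ (q b) = block 0 (ε • 1) (-semiProj γ u (-1)) 0) := by 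
  have : Nontrivial E := Module.nontrivial_of_finrank_pos (R := ℝ) (by rw [hdim]; norm_num)
  obtain ⟨hiff, hmodel⟩ := theorem4p5_general (by norm_num : 4 ∣ 8) hdim b
  refine ⟨fun S _ _ ρspin hS => ?_, fun V _ _ γ hγ => ⟨(hmodel V γ).1 hγ, fun u ε _ hB => ?_⟩⟩
  · have := hS.1
    rw [hiff, exists_eq_smul_id_iff_of_trace_eq_finrank (by rw [hnorm, hdim]; norm_num)]
  · have := hγ.1
    simpa only [semiProj_one, semiProj_neg_one] using (hmodel V γ).2 u ε hB
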